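/- Let $n\ge 1$ and let $K\subset\mathbb{R}^n$ be a compact convex set of positive measure with $K=-K$. Let $K^\circ=\{x\in\mathbb{R}^n : x\cdot y\le 1 \text{ for all } y\in K\}$ be its polar body, and let $B_K$ be the space of all bounded continuous functions $f:\mathbb{R}^n\to\mathbb{C}$ that are Fourier transforms $f=\widehat T$ of distributions $T$ supported by $K$, where $\widehat T(g)=T(\widehat g)$ and $\widehat g(t)=(2\pi)^{-n/2}\int_{\mathbb{R}^n}e^{-it\cdot x}g(x)\,dx$ for Schwartz functions $g$. Write $\|f\|_\infty=\sup_{\mathbb{R}^n}|f|$. Let $\Lambda\subset\mathbb{R}^n$ be a set such that $\Lambda+\rho K^\circ=\mathbb{R}^n$ for some $\rho$ with $0\le\rho<\pi/2$. Then $$\|f\|_\infty\le\frac{1}{\cos\rho}\,\sup_{\lambda\in\Lambda}|f(\lambda)|\qquad\text{for every } f\in B_K .$$ In particular, $\Lambda$ is a stable sampling set for $B_K$: there is a constant $C$, not depending on $f$, such that $\|f\|_\infty\le C\sup_{\lambda\in\Lambda}|f(\lambda)|$ for every $f\in B_K$. -/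

import Mathlib

open scoped SchwartzMap FourierTransform BoundedContinuousFunction Pointwise

noncomputable section

/-- The polar body `{x : x · y ≤ 1 for all y ∈ S}` of a set `S ⊆ ℝⁿ`. -/
def polarBody {n : ℕ} (S : Set (EuclideanSpace ℝ (Fin n))) : Set (EuclideanSpace ℝ (Fin n)) :=
  {x | ∀ y ∈ S, inner ℝ x y ≤ 1}

/-- The dilation `t ↦ t / (2π)` of `ℝⁿ`. -/
def dilationInvTwoPi (n : ℕ) : EuclideanSpace ℝ (Fin n) ≃L[ℝ] EuclideanSpace ℝ (Fin n) :=
  ContinuousLinearEquiv.smulLeft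
    (Units.mk0 ((2 * Real.pi)⁻¹ : ℝ) (inv_ne_zero Real.two_pi_pos.ne'))

/-- The Fourier transform `ĝ(t) = (2π)^{-n/2} ∫ e^{-i t·x} g(x) dx` on Schwartz functions, obtained
by rescaling Mathlib's `𝓕 g (ξ) = ∫ e^{-2πi ξ·x} g(x) dx`; the formula is `angularFourier_apply`. -/
def angularFourier (n : ℕ) :
    𝓢(EuclideanSpace ℝ (Fin n), ℂ) →L[ℂ] 𝓢(EuclideanSpace ℝ (Fin n), ℂ) :=
  (((2 * Real.pi) ^ (-(n : ℝ) / 2) : ℝ) : ℂ) •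
    (SchwartzMap.compCLMOfContinuousLinearEquiv ℂ (dilationInvTwoPi n)).comp
      (FourierTransform.fourierCLM ℂ 𝓢(EuclideanSpace ℝ (Fin n), ℂ))

theorem angularFourier_apply {n : ℕ} (g : 𝓢(EuclideanSpace ℝ (Fin n), ℂ))
    (t : EuclideanSpace ℝ (Fin n)) :
    angularFourier n g t = (((2 * Real.pi) ^ (-(n : ℝ) / 2) : ℝ) : ℂ) *
      ∫ x : EuclideanSpace ℝ (Fin n), Complex.exp (-Complex.I * (inner ℝ t x : ℝ)) * g x := by
  have h : angularFourier n g t = (((2 * Real.pi) ^ (-(n : ℝ) / 2) : ℝ) : ℂ) *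
      (𝓕 g) (((2 * Real.pi)⁻¹ : ℝ) • t) := rfl
  rw [h, SchwartzMap.fourier_coe, Real.fourier_eq']
  congr 1
  refine MeasureTheory.integral_congr_ae (Filter.Eventually.of_forall fun x => ?_)
  simp only [smul_eq_mul, real_inner_smul_right, real_inner_comm t x]
  congr 2
  have := Real.pi_ne_zero
  push_cast
  field_simp

/-- The Fourier transform of a tempered distribution: `T̂(g) = T(ĝ)`. -/
def distribFourier {n : ℕ} (T : 𝓢'(EuclideanSpace ℝ (Fin n), ℂ)) :
    𝓢'(EuclideanSpace ℝ (Fin n), ℂ) :=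
  PointwiseConvergenceCLM.precomp ℂ (angularFourier n) T

/-- The Bernstein space `B_S` of a compact set `S ⊆ ℝⁿ`, with the supremum norm: the bounded
continuous functions `f : ℝⁿ → ℂ` that are (as distributions) the Fourier transform of a
distribution `T` supported by `S`, i.e. one that vanishes on the open set `Sᶜ`.
(A distribution with compact support is automatically tempered.) -/
def bernsteinSpace {n : ℕ} (S : Set (EuclideanSpace ℝ (Fin n))) :
    Submodule ℂ (EuclideanSpace ℝ (Fin n) →ᵇ ℂ) where
  carrier := {f | ∃ T : 𝓢'(EuclideanSpace ℝ (Fin n), ℂ), Distribution.IsVanishingOn T Sᶜ ∧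
    ∀ g : 𝓢(EuclideanSpace ℝ (Fin n), ℂ), distribFourier T g = ∫ x, g x * f x}
  zero_mem' := ⟨0, fun _ _ => rfl, fun g => by
    change (0 : ℂ) = _
    simp⟩
  add_mem' := by
    rintro f₁ f₂ ⟨T₁, h₁, e₁⟩ ⟨T₂, h₂, e₂⟩
    refine ⟨T₁ + T₂, fun u hu => ?_, fun g => ?_⟩
    · have a := h₁ u hu
      have b := h₂ u hu
      change T₁ u + T₂ u = 0
      rw [a, b, add_zero]
    · have hi : ∀ f : EuclideanSpace ℝ (Fin n) →ᵇ ℂ,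
          MeasureTheory.Integrable (fun x => g x * f x) := fun f =>
        g.integrable.mul_bdd (c := ‖f‖) f.continuous.aestronglyMeasurable
          (Filter.Eventually.of_forall f.norm_coe_le_norm)
      change distribFourier T₁ g + distribFourier T₂ g = _
      rw [e₁, e₂, ← MeasureTheory.integral_add (hi f₁) (hi f₂)]
      simp [mul_add]
  smul_mem' := by
    rintro c f ⟨T, h, e⟩
    refine ⟨c • T, fun u hu => ?_, fun g => ?_⟩
    · have a := h u hu
      change c • T u = 0
      rw [a, smul_zero]
    · change c • distribFourier T g = _
      rw [e, ← MeasureTheory.integral_smul]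
      refine MeasureTheory.integral_congr_ae (Filter.Eventually.of_forall fun x => ?_)
      simp [mul_left_comm]

/-- `sup_{l ∈ L} |f(l)|`. -/
def supOn {n : ℕ} (L : Set (EuclideanSpace ℝ (Fin n)))
    (f : EuclideanSpace ℝ (Fin n) →ᵇ ℂ) : ℝ :=
  ⨆ l : L, ‖f l‖

/-- `L` is a stable sampling set for `B_S`: one constant `C` gives `‖f‖_∞ ≤ C sup_L |f|` for
every `f ∈ B_S`. -/
def IsStableSamplingSet {n : ℕ} (L S : Set (EuclideanSpace ℝ (Fin n))) : Prop :=
  ∃ C : ℝ, ∀ f ∈ bernsteinSpace S, ‖f‖ ≤ C * supOn L f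

end

/-! For `0 < δ`, `0 ≤ r`, `r + δ < π` and `b = sin δ / sin (r + δ)`, the function `exp (iδω) - b exp
(i(r+δ)ω)` has an absolutely convergent Fourier series on `[-1, 1]`. Its coefficients have signs
`(-1) ^ k`, so the sum of their absolute values is its real part at `ω = 1`, namely `cos δ - b cos
(r + δ)` (`hasSum_abs_extremalCoeff`). If `|t · v| ≤ 1` for `t ∈ K`, this relation between
exponentials passes to `f ∈ B_K` on lines of direction `v`: `f x - b f (x + ρ v)` is a combination
of values of `f` with total weight `cos δ - b cos (r + δ)`, where `r = τρ` and `τ > 1` leaves room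
for a cutoff around `K` (`tsum_apply_add_eq_zero_of_mem_bernsteinSpace`). The covering hypothesis
lets `x + ρ v` be a point of `Λ`, so `‖f‖ ≤ b sup_Λ |f| + (cos δ - b cos (r + δ)) ‖f‖`. Bound `cos
δ` by `1`, cancel `b`, and let `δ → 0`, `τ → 1`. -/

/-! ### The extremal Fourier series on `[-1, 1]`. -/

theorem integral_exp_neg_one_one {a : ℝ} (k : ℤ) (h : a - k * Real.pi ≠ 0) :
    ∫ x in (-1 : ℝ)..1, Complex.exp (((a - k * Real.pi : ℝ) : ℂ) * Complex.I * x) =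
      ((2 * ((-1) ^ k * Real.sin a / (a - k * Real.pi)) : ℝ) : ℂ) := by
  have h' : (((a - k * Real.pi : ℝ) : ℂ)) ≠ 0 := by exact_mod_cast h
  rw [integral_exp_mul_complex (mul_ne_zero h' Complex.I_ne_zero), ← Real.sin_sub_int_mul_pi]
  set z := a - k * Real.pi
  push_cast
  rw [Complex.sin]
  field_simp
  simp only [Complex.I_sq]
  ring_nf

/-- The Fourier coefficients on `[-1, 1]` of
`ω ↦ exp (i δ ω) - (sin δ / sin (r + δ)) exp (i (r + δ) ω)`. -/
noncomputable def extremalCoeff (r δ : ℝ) (k : ℤ) : ℝ :=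
  (-1) ^ k * (Real.sin δ * r / ((δ - k * Real.pi) * (r + δ - k * Real.pi)))

theorem sub_int_mul_pi_ne_zero {a : ℝ} (h0 : 0 < a) (h1 : a < Real.pi) (k : ℤ) :
    a - k * Real.pi ≠ 0 := by
  intro h
  have h2 : Real.sin a = 0 := Real.sin_eq_zero_iff.2 ⟨k, by linarith⟩
  exact (Real.sin_pos_of_pos_of_lt_pi h0 h1).ne' h2

/-- No multiple of `π` separates two points of `(0, π)`. This fixes the signs of the extremal
coefficients. -/
theorem sub_int_mul_pi_mul_pos {a b : ℝ} (ha : 0 < a) (ha' : a < Real.pi) (hb : 0 < b)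
    (hb' : b < Real.pi) (k : ℤ) : 0 < (a - k * Real.pi) * (b - k * Real.pi) := by
  rcases le_or_gt k 0 with hk | hk
  · have : (k : ℝ) ≤ 0 := by exact_mod_cast hk
    have := mul_nonneg (neg_nonneg.2 this) Real.pi_pos.le
    apply mul_pos <;> linarith
  · have : (1 : ℝ) ≤ k := by exact_mod_cast hk
    have := mul_le_mul_of_nonneg_right this Real.pi_pos.le
    apply mul_pos_of_neg_of_neg <;> linarith

section

variable {r δ : ℝ}

theorem summable_extremalCoeff (r δ : ℝ) : Summable (extremalCoeff r δ) := by
  have h1 : Summable fun k : ℤ => (1 : ℝ) / (k : ℝ) ^ 2 :=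
    Real.summable_one_div_int_pow.2 one_lt_two
  refine summable_of_isBigO h1 ?_
  have key : ∀ a : ℝ, (fun k : ℤ => (a - k * Real.pi)⁻¹) =O[Filter.cofinite]
      fun k : ℤ => ((k : ℝ))⁻¹ := by
    intro a
    have ht : Filter.Tendsto (fun k : ℤ => ‖(k : ℝ)‖) Filter.cofinite Filter.atTop :=
      (tendsto_norm_cocompact_atTop (E := ℝ)).comp Int.tendsto_coe_cofinite
    refine Asymptotics.IsBigO.of_bound 1 ?_
    filter_upwards [ht.eventually_ge_atTop (|a| + 1)] with k hk
    rw [norm_inv, norm_inv, one_mul]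
    have h2 : |(k : ℝ)| * 2 ≤ |(k : ℝ) * Real.pi| := by
      rw [abs_mul, abs_of_pos Real.pi_pos]
      exact mul_le_mul_of_nonneg_left Real.two_le_pi (abs_nonneg _)
    have h3 := abs_sub_abs_le_abs_sub ((k : ℝ) * Real.pi) a
    rw [Real.norm_eq_abs] at hk
    have h4 := abs_nonneg a
    apply inv_anti₀
    · rw [Real.norm_eq_abs]; linarith
    · rw [Real.norm_eq_abs, Real.norm_eq_abs, abs_sub_comm]; linarith
  have h2 := (((key δ).mul (key (r + δ))).const_mul_left (Real.sin δ * r))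
  refine Asymptotics.IsBigO.trans (Asymptotics.IsBigO.of_bound 1 ?_) (h2.trans ?_)
  · refine Filter.Eventually.of_forall fun k => ?_
    simp only [extremalCoeff]
    rw [norm_mul, norm_zpow, norm_neg, norm_one, one_zpow, div_eq_mul_inv, mul_inv]
  · refine Asymptotics.IsBigO.of_bound 1 (Filter.Eventually.of_forall fun k => ?_)
    rw [one_mul, one_div, sq, mul_inv]

theorem hasSum_extremalCoeff (hr : 0 ≤ r) (hδ : 0 < δ) (h : r + δ < Real.pi) {ω : ℝ}
    (hω : |ω| ≤ 1) :
    HasSum (fun k : ℤ => (extremalCoeff r δ k : ℂ) * Complex.exp (k * Real.pi * ω * Complex.I))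
      (Complex.exp (δ * ω * Complex.I) -
        ((Real.sin δ / Real.sin (r + δ) : ℝ) : ℂ) * Complex.exp ((r + δ) * ω * Complex.I)) := by
  have hs : 0 < Real.sin (r + δ) := Real.sin_pos_of_pos_of_lt_pi (by linarith) h
  set b : ℝ := Real.sin δ / Real.sin (r + δ) with hb
  let F : ℝ → ℂ := fun ω => Complex.exp (δ * ω * Complex.I) -
        (b : ℂ) * Complex.exp ((r + δ) * ω * Complex.I)
  have : Fact ((0 : ℝ) < 2) := ⟨two_pos⟩
  have hFc : Continuous F := by fun_prop
  -- The choice of `b` cancels the imaginary parts at `±1`, so the 2-periodic extension is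
  -- continuous.
  have hF1 : F (-1) = F (-1 + 2) := by
    have e1 : (-1 : ℝ) + 2 = 1 := by norm_num
    have e2 : b * Real.sin (r + δ) = Real.sin δ := div_mul_cancel₀ _ hs.ne'
    have e3 : (b : ℂ) * Complex.sin (r + δ) = Complex.sin δ := by exact_mod_cast congrArg Complex.ofReal e2
    rw [e1]
    simp only [F]
    rw [Complex.exp_mul_I, Complex.exp_mul_I, Complex.exp_mul_I, Complex.exp_mul_I]
    push_cast
    simp only [mul_neg, mul_one, Complex.cos_neg, Complex.sin_neg]
    linear_combination (2 * Complex.I) * e3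
  let G : C(AddCircle (2 : ℝ), ℂ) :=
    ⟨AddCircle.liftIco 2 (-1) F, AddCircle.liftIco_continuous hF1 hFc.continuousOn⟩
  have hcoef : ∀ k, fourierCoeff G k = (extremalCoeff r δ k : ℂ) := by
    intro k
    have := fourierCoeff_liftIco_eq (T := 2) (a := -1) F k
    change fourierCoeff (AddCircle.liftIco 2 (-1) F) k = _
    rw [this, fourierCoeffOn_eq_integral]
    have e1 : (-1 : ℝ) + 2 = 1 := by norm_num
    have hd := sub_int_mul_pi_ne_zero hδ (by linarith) k
    have hrd := sub_int_mul_pi_ne_zero (by linarith : 0 < r + δ) h k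
    have e2 : ∀ x : ℝ, fourier (-k) (x : AddCircle ((-1 : ℝ) + 2 - (-1))) • F x =
        Complex.exp (((δ - k * Real.pi : ℝ) : ℂ) * Complex.I * x) -
        b * Complex.exp (((r + δ - k * Real.pi : ℝ) : ℂ) * Complex.I * x) := by
      intro x
      rw [fourier_coe_apply, smul_eq_mul, mul_sub, ← Complex.exp_add, mul_left_comm,
        ← Complex.exp_add]
      congr 2
      · push_cast; ring
      · push_cast; ring_nf
    simp_rw [e2, e1]
    rw [intervalIntegral.integral_sub, intervalIntegral.integral_const_mul,
      integral_exp_neg_one_one k hd, integral_exp_neg_one_one k hrd, extremalCoeff, hb]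
    · rw [Complex.real_smul, show (1 / (1 - (-1)) : ℝ) = 1 / 2 by norm_num, ← Complex.ofReal_mul,
        ← Complex.ofReal_sub, ← Complex.ofReal_mul, Complex.ofReal_inj]
      field_simp
      ring
    · exact Continuous.intervalIntegrable (by fun_prop) _ _
    · exact Continuous.intervalIntegrable (by fun_prop) _ _
  have hsum : Summable (fourierCoeff G) := by
    rw [funext hcoef]
    exact Complex.ofRealCLM.summable (summable_extremalCoeff r δ)
  have hmem := abs_le.1 hω
  have main : ∀ ω : ℝ, ω ∈ Set.Ico (-1 : ℝ) (-1 + 2) →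
      HasSum (fun k : ℤ => (extremalCoeff r δ k : ℂ) * Complex.exp (k * Real.pi * ω * Complex.I))
      (F ω) := by
    intro ω hω
    have := has_pointwise_sum_fourier_series_of_summable hsum (ω : AddCircle (2 : ℝ))
    have e : G (ω : AddCircle (2 : ℝ)) = F ω := AddCircle.liftIco_coe_apply (f := F) hω
    rw [e] at this
    convert this using 2 with k
    rw [hcoef, fourier_coe_apply, smul_eq_mul]
    congr 2
    push_cast
    ring
  -- `Ico` omits `ω = 1`, which is recovered from `ω = -1` by periodicity.
  rcases eq_or_lt_of_le hmem.2 with h1 | h1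
  · have := main (-1) (by norm_num)
    rw [hF1, show (-1 : ℝ) + 2 = ω by linarith] at this
    convert this using 2 with k
    rw [h1]
    congr 1
    have : (k * Real.pi * ((1 : ℝ) : ℂ) * Complex.I) =
      k * Real.pi * ((-1 : ℝ) : ℂ) * Complex.I + k * (2 * Real.pi * Complex.I) := by
      push_cast; ring
    rw [this, Complex.exp_add, Complex.exp_int_mul_two_pi_mul_I, mul_one]
  · exact main ω ⟨hmem.1, by linarith⟩

theorem abs_extremalCoeff (hr : 0 ≤ r) (hδ : 0 < δ) (h : r + δ < Real.pi) (k : ℤ) :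
    |extremalCoeff r δ k| = (-1) ^ k * extremalCoeff r δ k := by
  have h1 := sub_int_mul_pi_mul_pos hδ (by linarith) (by linarith : 0 < r + δ) h k
  have h2 := Real.sin_pos_of_pos_of_lt_pi hδ (by linarith)
  rw [extremalCoeff, abs_mul, abs_zpow, abs_neg, abs_one, one_zpow, one_mul, ← mul_assoc,
    ← mul_zpow, neg_one_mul, neg_neg, one_zpow, one_mul]
  exact abs_of_nonneg (div_nonneg (mul_nonneg h2.le hr) h1.le)

/-- At `ω = 1` the exponentials equal `(-1) ^ k`, the signs of the coefficients, so the series there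
sums their absolute values. -/
theorem hasSum_abs_extremalCoeff (hr : 0 ≤ r) (hδ : 0 < δ) (h : r + δ < Real.pi) :
    HasSum (fun k => |extremalCoeff r δ k|)
      (Real.cos δ - Real.sin δ / Real.sin (r + δ) * Real.cos (r + δ)) := by
  have := Complex.reCLM.hasSum (hasSum_extremalCoeff hr hδ h (ω := 1) (by simp))
  convert this using 1
  · funext k
    rw [abs_extremalCoeff hr hδ h]
    have e : Complex.exp (k * Real.pi * ((1 : ℝ) : ℂ) * Complex.I) = (((-1 : ℝ) ^ k : ℝ) : ℂ) := by
      rw [Complex.ofReal_one, mul_one, mul_assoc, Complex.exp_int_mul, Complex.exp_pi_mul_I]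
      push_cast
      rfl
    simp only [e, Complex.reCLM_apply]
    rw [← Complex.ofReal_mul, Complex.ofReal_re, mul_comm]
  · rw [Complex.reCLM_apply, Complex.ofReal_one, mul_one, mul_one, Complex.sub_re,
      Complex.re_ofReal_mul, ← Complex.ofReal_add, Complex.exp_ofReal_mul_I_re,
      Complex.exp_ofReal_mul_I_re]

end

/-! ### Transfer of exponential relations to the Bernstein space. -/

section FourierFilter
open MeasureTheory

variable {n : ℕ} {χ : EuclideanSpace ℝ (Fin n) → ℂ}

/-- Multiplication of the Fourier transform of a Schwartz function by `χ` (in the angular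
frequency variable). -/
noncomputable def fourierFilter (χ : EuclideanSpace ℝ (Fin n) → ℂ)
    (g : 𝓢(EuclideanSpace ℝ (Fin n), ℂ)) : 𝓢(EuclideanSpace ℝ (Fin n), ℂ) :=
  𝓕⁻ (SchwartzMap.smulLeftCLM ℂ (fun u => χ ((2 * Real.pi) • u)) (𝓕 g))

theorem hasTemperateGrowth_comp_const_smul (hχ : χ.HasTemperateGrowth) (a : ℝ) :
    (fun u => χ (a • u)).HasTemperateGrowth :=
  hχ.comp (a • ContinuousLinearMap.id ℝ (EuclideanSpace ℝ (Fin n))).hasTemperateGrowth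

theorem angularFourier_fourierFilter (hχ : χ.HasTemperateGrowth)
    (g : 𝓢(EuclideanSpace ℝ (Fin n), ℂ)) (t : EuclideanSpace ℝ (Fin n)) :
    angularFourier n (fourierFilter χ g) t = χ t * angularFourier n g t := by
  have h : ∀ g : 𝓢(EuclideanSpace ℝ (Fin n), ℂ), angularFourier n g t =
      (((2 * Real.pi) ^ (-(n : ℝ) / 2) : ℝ) : ℂ) * (𝓕 g) (((2 * Real.pi)⁻¹ : ℝ) • t) :=
    fun _ => rfl
  rw [h, h, fourierFilter, FourierTransform.fourier_fourierInv_eq,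
    SchwartzMap.smulLeftCLM_apply_apply (hasTemperateGrowth_comp_const_smul hχ _),
    smul_inv_smul₀ Real.two_pi_pos.ne', smul_eq_mul, mul_left_comm]

/-- Filtering changes the transform of `g` by `(χ - 1) ĝ`, which is supported off `S`, where `T`
vanishes. -/
theorem integral_fourierFilter_mul {S : Set (EuclideanSpace ℝ (Fin n))}
    {f : EuclideanSpace ℝ (Fin n) →ᵇ ℂ} (hf : f ∈ bernsteinSpace S) (hχ : χ.HasTemperateGrowth)
    (hS : tsupport (fun t => 1 - χ t) ⊆ Sᶜ) (g : 𝓢(EuclideanSpace ℝ (Fin n), ℂ)) :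
    ∫ x, fourierFilter χ g x * f x = ∫ x, g x * f x := by
  obtain ⟨T, hT, hTf⟩ := hf
  rw [← hTf, ← hTf]
  change T (angularFourier n _) = T (angularFourier n _)
  rw [eq_comm, ← sub_eq_zero, ← map_sub]
  refine hT _ (Set.Subset.trans ?_ hS)
  refine closure_mono fun t ht => ?_
  contrapose! ht
  simp only [Function.mem_support, not_not] at ht ⊢
  rw [sub_apply, angularFourier_fourierFilter hχ, ← one_sub_mul, ht, zero_mul]

theorem fourierFilter_apply (hχ : χ.HasTemperateGrowth) (g : 𝓢(EuclideanSpace ℝ (Fin n), ℂ))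
    (y : EuclideanSpace ℝ (Fin n)) :
    fourierFilter χ g y = ∫ u, Complex.exp (((2 * Real.pi * inner ℝ u y : ℝ) : ℂ) * Complex.I) *
      (χ ((2 * Real.pi) • u) * (𝓕 g) u) := by
  rw [fourierFilter, SchwartzMap.fourierInv_coe, Real.fourierInv_eq']
  simp [SchwartzMap.smulLeftCLM_apply_apply (hasTemperateGrowth_comp_const_smul hχ _)]

theorem fourier_compSubConst (g : 𝓢(EuclideanSpace ℝ (Fin n), ℂ))
    (a u : EuclideanSpace ℝ (Fin n)) :
    (𝓕 (g.compSubConstCLM ℂ a)) u =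
      Complex.exp (((-(2 * Real.pi * inner ℝ u a) : ℝ) : ℂ) * Complex.I) * (𝓕 g) u := by
  rw [SchwartzMap.fourier_coe, SchwartzMap.fourier_coe, Real.fourier_eq', Real.fourier_eq',
    ← integral_const_mul, ← integral_add_right_eq_self _ a]
  congr 1 with x
  rw [SchwartzMap.compSubConstCLM_apply, add_sub_cancel_right, smul_eq_mul, smul_eq_mul,
    ← mul_assoc, ← Complex.exp_add, inner_add_left, real_inner_comm a u]
  congr 2
  push_cast
  ring

theorem fourierFilter_compSubConst (hχ : χ.HasTemperateGrowth)
    (g : 𝓢(EuclideanSpace ℝ (Fin n), ℂ)) (a y : EuclideanSpace ℝ (Fin n)) :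
    fourierFilter χ (g.compSubConstCLM ℂ a) y = fourierFilter χ g (y - a) := by
  rw [fourierFilter_apply hχ, fourierFilter_apply hχ]
  congr 1 with u
  rw [fourier_compSubConst, mul_left_comm (χ _), ← mul_assoc, ← Complex.exp_add, inner_sub_right]
  congr 2
  push_cast
  ring

variable {ι : Type*} [Countable ι] {c : ι → ℂ} {v : ι → EuclideanSpace ℝ (Fin n)}

/-- On the Fourier side the sum is the transform of `g` times `χ` times the exponential sum, and the
latter vanishes wherever `χ` does not. -/
theorem hasSum_fourierFilter_sub (hχ : χ.HasTemperateGrowth) (hc : Summable fun j => ‖c j‖)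
    (hv : ∀ t, χ t ≠ 0 →
      HasSum (fun j => c j * Complex.exp (((-inner ℝ t (v j) : ℝ) : ℂ) * Complex.I)) 0)
    (g : 𝓢(EuclideanSpace ℝ (Fin n), ℂ)) (y : EuclideanSpace ℝ (Fin n)) :
    HasSum (fun j => c j * fourierFilter χ g (y - v j)) 0 := by
  let w := SchwartzMap.smulLeftCLM ℂ (fun u => χ ((2 * Real.pi) • u)) (𝓕 g)
  have hw : ∀ u, χ ((2 * Real.pi) • u) * (𝓕 g) u = w u := fun u =>
    (SchwartzMap.smulLeftCLM_apply_apply (hasTemperateGrowth_comp_const_smul hχ _) _ u).symm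
  let F : ι → EuclideanSpace ℝ (Fin n) → ℂ := fun j u =>
    (c j * Complex.exp (((2 * Real.pi * inner ℝ u (y - v j) : ℝ) : ℂ) * Complex.I)) * w u
  have hF : ∀ j u, ‖F j u‖ = ‖c j‖ * ‖w u‖ := fun j u => by
    simp only [F]
    rw [norm_mul, norm_mul, Complex.norm_exp_ofReal_mul_I, mul_one]
  have hFi : ∀ j, Integrable (F j) := fun j =>
    w.integrable.bdd_mul (c := ‖c j‖)
      (Continuous.aestronglyMeasurable (by fun_prop)) (Filter.Eventually.of_forall fun u => by
        rw [norm_mul, Complex.norm_exp_ofReal_mul_I, mul_one])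
  have hFs : Summable fun j => ∫ u, ‖F j u‖ := by
    simp_rw [hF, integral_const_mul]
    exact hc.mul_right _
  have key := hasSum_integral_of_summable_integral_norm hFi hFs
  have hzero : ∀ u, ∑' j, F j u = 0 := by
    intro u
    by_cases hu : χ ((2 * Real.pi) • u) = 0
    · simp [F, ← hw, hu]
    · have h1 := (hv _ hu).mul_right
        (Complex.exp (((2 * Real.pi * inner ℝ u y : ℝ) : ℂ) * Complex.I) * w u)
      rw [zero_mul] at h1
      refine HasSum.tsum_eq (h1.congr_fun ?_)
      intro j
      have e : Complex.exp (((2 * Real.pi * inner ℝ u (y - v j) : ℝ) : ℂ) * Complex.I) =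
          Complex.exp (((-inner ℝ ((2 * Real.pi) • u) (v j) : ℝ) : ℂ) * Complex.I) *
            Complex.exp (((2 * Real.pi * inner ℝ u y : ℝ) : ℂ) * Complex.I) := by
        rw [← Complex.exp_add, inner_sub_right, real_inner_smul_left]
        congr 1
        push_cast
        ring
      simp only [F]
      rw [e]
      ring
  simp_rw [hzero, integral_zero] at key
  refine key.congr_fun fun j => ?_
  rw [fourierFilter_apply hχ, ← integral_const_mul]
  congr 1 with u
  rw [hw, ← mul_assoc]

/-- A linear relation between the exponentials with frequencies in a neighbourhood of `S` holds
for all functions of the Bernstein space of `S`. -/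
theorem tsum_apply_add_eq_zero_of_mem_bernsteinSpace {S : Set (EuclideanSpace ℝ (Fin n))}
    {f : EuclideanSpace ℝ (Fin n) →ᵇ ℂ} (hf : f ∈ bernsteinSpace S) (hχ : χ.HasTemperateGrowth)
    (hS : tsupport (fun t => 1 - χ t) ⊆ Sᶜ) (hc : Summable fun j => ‖c j‖)
    (hv : ∀ t, χ t ≠ 0 →
      HasSum (fun j => c j * Complex.exp (((-inner ℝ t (v j) : ℝ) : ℂ) * Complex.I)) 0)
    (x : EuclideanSpace ℝ (Fin n)) : ∑' j, c j * f (x + v j) = 0 := by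
  let D : EuclideanSpace ℝ (Fin n) → ℂ := fun x => ∑' j, c j * f (x + v j)
  have hb : ∀ j x, ‖c j * f (x + v j)‖ ≤ ‖c j‖ * ‖f‖ := fun j x => by
    rw [norm_mul]
    exact mul_le_mul_of_nonneg_left (f.norm_coe_le_norm _) (norm_nonneg _)
  have hD : Continuous D := continuous_tsum (fun j => by fun_prop) (hc.mul_right ‖f‖) hb
  have hi : ∀ (g : 𝓢(EuclideanSpace ℝ (Fin n), ℂ)) (a : EuclideanSpace ℝ (Fin n)),
      Integrable fun x => g x * f (x + a) := fun g a =>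
    g.integrable.mul_bdd (c := ‖f‖) (Continuous.aestronglyMeasurable (by fun_prop))
      (Filter.Eventually.of_forall fun x => f.norm_coe_le_norm _)
  have hi' : ∀ (g : 𝓢(EuclideanSpace ℝ (Fin n), ℂ)) (a : EuclideanSpace ℝ (Fin n)),
      Integrable fun x => g (x - a) * f x := fun g a => by
    simpa using hi (g.compSubConstCLM ℂ a) 0
  have hsum : ∀ h : 𝓢(EuclideanSpace ℝ (Fin n), ℂ),
      HasSum (fun j => ∫ x, h x * (c j * f (x + v j))) (∫ x, h x * D x) := by
    intro h
    have := hasSum_integral_of_summable_integral_norm (μ := volume)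
      (F := fun j x => h x * (c j * f (x + v j))) (fun j => by
        simpa only [mul_left_comm] using (hi h (v j)).const_mul (c j)) ?_
    · simpa only [tsum_mul_left] using this
    · refine Summable.of_nonneg_of_le (fun j => integral_nonneg fun x => norm_nonneg _) (fun j => ?_)
        (hc.mul_right ((∫ x, ‖h x‖) * ‖f‖))
      rw [← mul_assoc, mul_comm ‖c j‖, mul_assoc, ← integral_mul_const]
      refine integral_mono_of_nonneg (Filter.Eventually.of_forall fun x => norm_nonneg _)
        (h.integrable.norm.mul_const _) (Filter.Eventually.of_forall fun x => ?_)
      change ‖h x * _‖ ≤ _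
      rw [norm_mul]
      exact mul_le_mul_of_nonneg_left (hb j x) (norm_nonneg _)
  have hshift : ∀ (h : 𝓢(EuclideanSpace ℝ (Fin n), ℂ)) (a : EuclideanSpace ℝ (Fin n)),
      ∫ x, h x * f (x + a) = ∫ x, h (x - a) * f x := fun h a => by
    rw [← integral_add_right_eq_self (fun x => h (x - a) * f x) a]
    simp
  have hterm : ∀ (h : 𝓢(EuclideanSpace ℝ (Fin n), ℂ)) (j : ι),
      ∫ x, h x * (c j * f (x + v j)) = c j * ∫ x, h (x - v j) * f x := fun h j => by
    rw [← hshift, ← integral_const_mul]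
    simp only [mul_left_comm]
  -- Against `f`, each translate of `g` may be replaced by its filtered version; the translates of
  -- the filtered function then sum to zero pointwise.
  have hzero : ∀ g : 𝓢(EuclideanSpace ℝ (Fin n), ℂ), ∫ x, g x * D x = 0 := by
    intro g
    have h1 : ∀ j, ∫ x, g x * (c j * f (x + v j)) =
        ∫ x, fourierFilter χ g x * (c j * f (x + v j)) := fun j => by
      rw [hterm, hterm]
      have := integral_fourierFilter_mul hf hχ hS (g.compSubConstCLM ℂ (v j))
      simp only [fourierFilter_compSubConst hχ, SchwartzMap.compSubConstCLM_apply] at this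
      rw [this]
    have h2 := hsum g
    simp only [h1] at h2
    rw [h2.unique (hsum _)]
    have h3 := hasSum_integral_of_summable_integral_norm (μ := volume)
      (F := fun j x => c j * fourierFilter χ g (x - v j) * f x) (fun j => by
        simpa only [mul_assoc] using (hi' (fourierFilter χ g) (v j)).const_mul (c j)) ?_
    · have h4 : ∀ x, ∑' j, c j * fourierFilter χ g (x - v j) * f x = 0 := fun x => by
        rw [tsum_mul_right, (hasSum_fourierFilter_sub hχ hc hv g x).tsum_eq, zero_mul]
      simp only [h4, integral_zero] at h3
      simp only [mul_assoc, integral_const_mul] at h3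
      refine (hsum _).unique ?_
      simpa only [hterm] using h3
    · have h5 : ∀ j, ∫ x, ‖c j * fourierFilter χ g (x - v j) * f x‖ =
          ‖c j‖ * ∫ x, ‖fourierFilter χ g x * f (x + v j)‖ := fun j => by
        rw [← integral_add_right_eq_self _ (v j), ← integral_const_mul]
        simp [mul_assoc]
      refine Summable.of_nonneg_of_le (fun j => integral_nonneg fun x => norm_nonneg _) (fun j => ?_)
        (hc.mul_right ((∫ x, ‖fourierFilter χ g x‖) * ‖f‖))
      rw [h5, ← integral_mul_const]
      refine mul_le_mul_of_nonneg_left ?_ (norm_nonneg _)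
      refine integral_mono_of_nonneg (Filter.Eventually.of_forall fun x => norm_nonneg _)
        ((fourierFilter χ g).integrable.norm.mul_const _) (Filter.Eventually.of_forall fun x => ?_)
      change ‖_ * _‖ ≤ _
      rw [norm_mul]
      exact mul_le_mul_of_nonneg_left (f.norm_coe_le_norm _) (norm_nonneg _)
  have hae : ∀ᵐ x, D x = 0 := by
    refine ae_eq_zero_of_integral_contDiff_smul_eq_zero hD.locallyIntegrable fun g hg hgc => ?_
    have hgc' : HasCompactSupport fun x => (g x : ℂ) := hgc.comp_left Complex.ofReal_zero
    have hg' : ContDiff ℝ (⊤ : ℕ∞) fun x => (g x : ℂ) := Complex.ofRealCLM.contDiff.comp hg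
    simpa using hzero (hgc'.toSchwartzMap hg')
  exact congrFun (Measure.eq_of_ae_eq hae hD continuous_const) x

end FourierFilter

/-! ### Interpolation on lines and the sampling bound. -/

section Sampling

variable {n : ℕ}

theorem exists_hasTemperateGrowth_cutoff (v : EuclideanSpace ℝ (Fin n)) {τ : ℝ} (hτ : 1 < τ) :
    ∃ χ : EuclideanSpace ℝ (Fin n) → ℂ, χ.HasTemperateGrowth ∧
      (∀ t ∈ tsupport (fun t => 1 - χ t), 1 < |inner ℝ t v|) ∧
      ∀ t, χ t ≠ 0 → |inner ℝ t v| ≤ τ := by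
  -- An inner radius strictly above `1` keeps even the closed support of `1 - χ` in `|t · v| > 1`.
  let β : ContDiffBump (0 : ℝ) := ⟨(1 + τ) / 2, τ, by linarith, by linarith⟩
  have hβ : Function.HasTemperateGrowth fun s : ℝ => β s :=
    β.hasCompactSupport.hasTemperateGrowth β.contDiff
  refine ⟨fun t => ((β (inner ℝ t v) : ℝ) : ℂ), ?_, fun t ht => ?_, fun t ht => ?_⟩
  · exact Function.Complex.hasTemperateGrowth_ofReal.comp
      (hβ.comp (Function.hasTemperateGrowth_inner_left v))
  · have hcl : IsClosed {t : EuclideanSpace ℝ (Fin n) | (1 + τ) / 2 ≤ |inner ℝ t v|} :=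
      isClosed_le continuous_const (by fun_prop)
    have hsub : tsupport (fun t : EuclideanSpace ℝ (Fin n) =>
        1 - ((β (inner ℝ t v) : ℝ) : ℂ)) ⊆ {t | (1 + τ) / 2 ≤ |inner ℝ t v|} := by
      refine closure_minimal (fun t ht => ?_) hcl
      by_contra hlt
      refine ht ?_
      have : β (inner ℝ t v) = 1 := β.one_of_mem_closedBall (by
        rw [mem_closedBall_zero_iff]
        exact (not_le.1 hlt).le)
      simp [this]
    have : (1 + τ) / 2 ≤ |inner ℝ t v| := hsub ht
    linarith
  · have h1 : β (inner ℝ t v) ≠ 0 := Complex.ofReal_ne_zero.1 ht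
    have h2 : inner ℝ t v ∈ Metric.ball (0 : ℝ) τ := β.support_eq ▸ h1
    rw [mem_ball_zero_iff] at h2
    exact h2.le

/-- Interpolation formula for the restrictions of functions of a Bernstein space to lines. -/
theorem hasSum_extremalCoeff_apply_add_smul {S : Set (EuclideanSpace ℝ (Fin n))}
    {f : EuclideanSpace ℝ (Fin n) →ᵇ ℂ} (hf : f ∈ bernsteinSpace S)
    {v : EuclideanSpace ℝ (Fin n)} (hv : ∀ t ∈ S, |inner ℝ t v| ≤ 1) {ρ δ τ : ℝ} (hρ : 0 ≤ ρ)
    (hδ : 0 < δ) (hτ : 1 < τ) (h : τ * ρ + δ < Real.pi) (x : EuclideanSpace ℝ (Fin n)) :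
    HasSum (fun k : ℤ => (extremalCoeff (τ * ρ) δ k : ℂ) * f (x + ((k * Real.pi - δ) / τ) • v))
      (f x - ((Real.sin δ / Real.sin (τ * ρ + δ) : ℝ) : ℂ) * f (x + ρ • v)) := by
  obtain ⟨χ, hχ, hχ1, hχ2⟩ := exists_hasTemperateGrowth_cutoff v hτ
  set b : ℝ := Real.sin δ / Real.sin (τ * ρ + δ)
  have hr : 0 ≤ τ * ρ := mul_nonneg (by linarith) hρ
  have hτ0 : (τ : ℂ) ≠ 0 := by exact_mod_cast (by linarith : τ ≠ 0)
  -- The series and the two terms `f x` and `b f (x + ρ v)` are joined into one vanishing relation.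
  let c : ℤ ⊕ Bool → ℂ :=
    Sum.elim (fun k => (extremalCoeff (τ * ρ) δ k : ℂ)) (fun i => bif i then -1 else (b : ℂ))
  let w : ℤ ⊕ Bool → EuclideanSpace ℝ (Fin n) :=
    Sum.elim (fun k => ((k * Real.pi - δ) / τ) • v) (fun i => bif i then 0 else ρ • v)
  have hc : Summable fun j => ‖c j‖ := by
    refine Summable.sum _ ?_ (Summable.of_finite)
    simpa [c, Function.comp_def] using (hasSum_abs_extremalCoeff hr hδ h).summable
  have hbool : ∀ F : Bool → ℂ, HasSum F (F true + F false) := fun F => by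
    simpa using hasSum_fintype F
  have hw : ∀ t, χ t ≠ 0 →
      HasSum (fun j => c j * Complex.exp (((-inner ℝ t (w j) : ℝ) : ℂ) * Complex.I)) 0 := by
    intro t ht
    set s : ℝ := inner ℝ t v with hs
    have hsτ : |-(s / τ)| ≤ 1 := by
      rw [abs_neg, abs_div, abs_of_pos (by linarith : 0 < τ), div_le_one (by linarith)]
      exact hχ2 t ht
    -- With `ω = -s / τ`, this factor turns the term `exp (iδω)` into `1`, which represents `f x`.
    have h1 := (hasSum_extremalCoeff hr hδ h hsτ).mul_right
      (Complex.exp (δ * (s / τ : ℝ) * Complex.I))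
    have h2 := HasSum.sum (f := fun j => c j * Complex.exp (((-inner ℝ t (w j) : ℝ) : ℂ) * Complex.I))
      (h1.congr_fun ?_) (hbool _)
    · convert h2 using 1
      simp only [c, w, Function.comp, Sum.elim_inr, cond_true, cond_false, inner_zero_right,
        inner_smul_right, ← hs]
      rw [sub_mul, mul_assoc (b : ℂ), ← Complex.exp_add, ← Complex.exp_add]
      have e1 : (δ * ((-(s / τ) : ℝ) : ℂ) * Complex.I + δ * ((s / τ : ℝ) : ℂ) * Complex.I) = 0 := by
        push_cast; ring
      have e2 : (((τ * ρ : ℝ) : ℂ) + δ) * ((-(s / τ) : ℝ) : ℂ) * Complex.I +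
          δ * ((s / τ : ℝ) : ℂ) * Complex.I = ((-(ρ * s) : ℝ) : ℂ) * Complex.I := by
        push_cast; field_simp; ring
      rw [e1, e2]
      simp
    · intro k
      simp only [c, w, Function.comp, Sum.elim_inl, inner_smul_right, ← hs]
      rw [mul_assoc, ← Complex.exp_add]
      congr 2
      push_cast; field_simp; ring
  have key := tsum_apply_add_eq_zero_of_mem_bernsteinSpace hf hχ
    (fun t ht htS => absurd (hv t htS) (not_le.2 (hχ1 t ht))) hc hw x
  have hsum : Summable fun k : ℤ =>
      (extremalCoeff (τ * ρ) δ k : ℂ) * f (x + ((k * Real.pi - δ) / τ) • v) := by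
    refine Summable.of_norm_bounded ((hasSum_abs_extremalCoeff hr hδ h).summable.mul_right ‖f‖)
      fun k => ?_
    rw [norm_mul, Complex.norm_real, Real.norm_eq_abs]
    exact mul_le_mul_of_nonneg_left (f.norm_coe_le_norm _) (abs_nonneg _)
  have h3 := HasSum.sum (f := fun j => c j * f (x + w j)) hsum.hasSum (hbool _)
  rw [h3.tsum_eq] at key
  simp only [c, w, Function.comp, Sum.elim_inr, cond_true, cond_false, add_zero] at key
  convert hsum.hasSum using 1
  linear_combination -key

theorem cos_mul_norm_le_of_mem_bernsteinSpace {S : Set (EuclideanSpace ℝ (Fin n))}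
    {f : EuclideanSpace ℝ (Fin n) →ᵇ ℂ} (hf : f ∈ bernsteinSpace S) {ρ δ τ m : ℝ} (hρ : 0 ≤ ρ)
    (hδ : 0 < δ) (hτ : 1 < τ) (h : τ * ρ + δ < Real.pi)
    (hm : ∀ x, ∃ v : EuclideanSpace ℝ (Fin n), (∀ t ∈ S, |inner ℝ t v| ≤ 1) ∧
      ‖f (x + ρ • v)‖ ≤ m) : Real.cos (τ * ρ + δ) * ‖f‖ ≤ m := by
  have hr : 0 ≤ τ * ρ := mul_nonneg (by linarith) hρ
  have hb : 0 < Real.sin δ / Real.sin (τ * ρ + δ) :=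
    div_pos (Real.sin_pos_of_pos_of_lt_pi hδ (by linarith))
      (Real.sin_pos_of_pos_of_lt_pi (by linarith) h)
  have hsum := hasSum_abs_extremalCoeff hr hδ h
  set b : ℝ := Real.sin δ / Real.sin (τ * ρ + δ)
  have hle : ‖f‖ ≤ b * m + (Real.cos δ - b * Real.cos (τ * ρ + δ)) * ‖f‖ := by
    refine BoundedContinuousFunction.norm_le_of_nonempty.2 fun x => ?_
    obtain ⟨v, hv, hfv⟩ := hm x
    have h1 := hasSum_extremalCoeff_apply_add_smul hf hv hρ hδ hτ h x
    have h2 := h1.norm_le_of_bounded (hsum.mul_right ‖f‖) fun k => by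
      rw [norm_mul, Complex.norm_real, Real.norm_eq_abs]
      exact mul_le_mul_of_nonneg_left (f.norm_coe_le_norm _) (abs_nonneg _)
    have h3 : ‖(b : ℂ) * f (x + ρ • v)‖ ≤ b * m := by
      rw [norm_mul, Complex.norm_real, Real.norm_eq_abs, abs_of_pos hb]
      exact mul_le_mul_of_nonneg_left hfv hb.le
    linarith [norm_sub_norm_le (f x) ((b : ℂ) * f (x + ρ • v))]
  have h4 : Real.cos δ * ‖f‖ ≤ ‖f‖ := mul_le_of_le_one_left (norm_nonneg _) (Real.cos_le_one _)
  have h5 : b * (Real.cos (τ * ρ + δ) * ‖f‖) ≤ b * m := by linarith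
  exact le_of_mul_le_mul_left h5 hb

theorem norm_le_supOn {L : Set (EuclideanSpace ℝ (Fin n))} (f : EuclideanSpace ℝ (Fin n) →ᵇ ℂ)
    {l : EuclideanSpace ℝ (Fin n)} (hl : l ∈ L) : ‖f l‖ ≤ supOn L f :=
  le_ciSup (f := fun l : L => ‖f l‖) ⟨‖f‖, by rintro _ ⟨l, rfl⟩; exact f.norm_coe_le_norm _⟩ ⟨l, hl⟩

theorem norm_le_inv_cos_mul_supOn {S L : Set (EuclideanSpace ℝ (Fin n))}
    (hsymm : ∀ x ∈ S, -x ∈ S) {ρ : ℝ} (hρ0 : 0 ≤ ρ) (hρ : ρ < Real.pi / 2)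
    (hcover : L + ρ • polarBody S = Set.univ) {f : EuclideanSpace ℝ (Fin n) →ᵇ ℂ}
    (hf : f ∈ bernsteinSpace S) : ‖f‖ ≤ 1 / Real.cos ρ * supOn L f := by
  have hcos : 0 < Real.cos ρ := Real.cos_pos_of_mem_Ioo ⟨by linarith, hρ⟩
  rw [one_div, ← div_eq_inv_mul, le_div_iff₀ hcos, mul_comm]
  have hm : ∀ x, ∃ v : EuclideanSpace ℝ (Fin n), (∀ t ∈ S, |inner ℝ t v| ≤ 1) ∧
      ‖f (x + ρ • v)‖ ≤ supOn L f := by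
    intro x
    obtain ⟨l, hl, _, ⟨k, hk, rfl⟩, hx⟩ := Set.mem_add.1 (hcover ▸ Set.mem_univ x)
    -- Since `x = l + ρ k`, the direction `-k` leads from `x` to `l`; symmetry of `S` bounds `|t ·
    -- k|` on both sides.
    refine ⟨-k, fun t ht => ?_, ?_⟩
    · have h1 := hk t ht
      have h2 := hk (-t) (hsymm t ht)
      rw [inner_neg_right] at h2
      rw [inner_neg_right, abs_neg, real_inner_comm, abs_le]
      constructor <;> linarith
    · rw [← hx, smul_neg, add_neg_cancel_right]
      exact norm_le_supOn f hl
  -- A single parameter suffices, with `τ = 1 + δ`.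
  have hlim : Filter.Tendsto (fun δ : ℝ => (1 + δ) * ρ + δ) (nhdsWithin 0 (Set.Ioi 0)) (nhds ρ) := by
    have : Continuous fun δ : ℝ => (1 + δ) * ρ + δ := by fun_prop
    simpa using (this.tendsto 0).mono_left nhdsWithin_le_nhds
  refine le_of_tendsto (((Real.continuous_cos.tendsto ρ).comp hlim).mul_const ‖f‖) ?_
  filter_upwards [hlim.eventually_lt_const (show ρ < Real.pi by linarith [Real.pi_pos]),
    self_mem_nhdsWithin] with δ h (hδ : 0 < δ)
  exact cos_mul_norm_le_of_mem_bernsteinSpace hf hρ0 hδ (by linarith) h hm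

end Sampling

theorem theorem4p1 {n : ℕ} (hn : 1 ≤ n)
    (K : ConvexBody (EuclideanSpace ℝ (Fin n)))
    (hsymm : ∀ x ∈ K, -x ∈ K)
    (hpos : 0 < MeasureTheory.volume (K : Set (EuclideanSpace ℝ (Fin n))))
    (L : Set (EuclideanSpace ℝ (Fin n)))
    (ρ : ℝ) (hρ0 : 0 ≤ ρ) (hρ : ρ < Real.pi / 2)
    (hcover : L + ρ • polarBody (K : Set (EuclideanSpace ℝ (Fin n))) = Set.univ) :
    (∀ f ∈ bernsteinSpace (K : Set (EuclideanSpace ℝ (Fin n))),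
      ‖f‖ ≤ 1 / Real.cos ρ * supOn L f) ∧
    IsStableSamplingSet L (K : Set (EuclideanSpace ℝ (Fin n))) :=
  have h : ∀ f ∈ bernsteinSpace (K : Set (EuclideanSpace ℝ (Fin n))),
      ‖f‖ ≤ 1 / Real.cos ρ * supOn L f := fun _ hf =>
    norm_le_inv_cos_mul_supOn (S := (K : Set (EuclideanSpace ℝ (Fin n)))) hsymm hρ0 hρ hcover hf
  ⟨h, _, h⟩
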